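/- **Theorem (Typing ensures update consistency).** Consider the session $\pi$-calculus with located processes $l^{h}[P]$ and update processes $l\{(\mathsf X).P\}$, defined as follows; here $h\in\mathbb Z$ is a run-time annotation, $k$ is a session variable $x$ or a polarized channel $\kappa^p$ ($p\in\{+,-\}$, $\overline{+}=-$, $\overline{-}=+$), and processes are taken up to renaming of bound names: $$P ::= \mathbf 0 \mid P\,|\,Q \mid (\nu\kappa)P \mid \mathsf{acc}\,a(x).P \mid {!}\mathsf{acc}\,a(x).P \mid \mathsf{req}\,a(x).P \mid l^{h}[P] \mid \mathsf X \mid l\{(\mathsf X).P\} \mid k\langle\tilde e\rangle.P \mid k(\tilde x).P \mid k\langle\!\langle k'\rangle\!\rangle.P \mid k(\!(x)\!).P \mid k\triangleright\{n_i{:}P_i\}_{1\le i\le m} \mid k\triangleleft n;P \mid \mathsf{if}\ e\ \mathsf{then}\ P\ \mathsf{else}\ Q \mid \mathsf{close}(k).P$$ with $m\ge 1$. *Structural congruence* $\equiv$ is the least congruence making $|$ a commutative monoid with unit $\mathbf 0$ and containing $(\nu\kappa)\mathbf 0\equiv\mathbf 0$, $(\nu\kappa)(\nu\kappa')P\equiv(\nu\kappa')(\nu\kappa)P$,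 $(\nu\kappa)P\,|\,Q\equiv(\nu\kappa)(P\,|\,Q)$ for $\kappa$ not free in $Q$, and $l^h[(\nu\kappa)P]\equiv(\nu\kappa)l^h[P]$. *Reduction.* Contexts are $C ::= \bullet \mid l^{h}[C\,|\,P]$; $C^{+},C^{++},C^{-},C^{--}$ denote $C$ with $1,2,-1,-2$ added to all annotations on the path to the hole. Reduction $\to$ is the closure under $\equiv$, $\cdot\,|\,Q$ and $(\nu\kappa)\,\cdot$ of the rules - $E\{C\{\mathsf{acc}\,a(x).P\}|D\{\mathsf{req}\,a(y).Q\}\}\to E^{++}\{(\nu\kappa)(C^{+}\{P\{\kappa^+/x\}\}|D^{+}\{Q\{\kappa^- /y\}\})\}$ with $\kappa$ fresh, and the same for ${!}\mathsf{acc}\,a(x).P$, which is kept in parallel with $P\{\kappa^+/x\}$; - (update) $E\{C\{l^{0}[Q]\}|D\{l\{(\mathsf X).P\}\}\}\to E\{C\{P\{Q/\mathsf X\}\}|D\{\mathbf 0\}\}$; - $E\{C\{\kappa^p\langle\tilde e\rangle.P\}|D\{\kappa^{\overline p}(\tilde x).Q\}\}\to E\{C\{P\}|D\{Q\{\tilde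 c/\tilde x\}\}\}$ if $\tilde e$ evaluates to $\tilde c$; - $E\{C\{\kappa^p\langle\!\langle \kappa'^q\rangle\!\rangle.P\}|D\{\kappa^{\overline p}(\!(x)\!).Q\}\}\to E\{C^{-}\{P\}|D^{+}\{Q\{\kappa'^q/x\}\}\}$; - $E\{C\{\kappa^p\triangleright\{n_i{:}P_i\}_{i}\}|D\{\kappa^{\overline p}\triangleleft n_j;Q\}\}\to E\{C\{P_j\}|D\{Q\}\}$; - $E\{C\{\mathsf{close}(\kappa^p).P\}|D\{\mathsf{close}(\kappa^{\overline p}).Q\}\}\to E^{--}\{C^{-}\{P\}|D^{-}\{Q\}\}$; - $C\{\mathsf{if}\ e\ \mathsf{then}\ P\ \mathsf{else}\ Q\}\to C\{P\}$ if $e$ evaluates to true, and $\to C\{Q\}$ if $e$ evaluates to false. $\to_{\mathrm{upd}}$ is the closure under $\equiv$, $\cdot\,|\,Q$ and $(\nu\kappa)\,\cdot$ of the update rule alone. *Typing.* Session types are $\alpha::={!}(\tilde\tau).\alpha\mid{?}(\tilde\tau).\alpha\mid{!}(\beta).\alpha\mid{?}(\beta).\alpha\mid\&\{n_i:\alpha_i\}_i\mid\oplus\{n_i:\alpha_i\}_i\mid\epsilon$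 with basic types $\tau$, distinct labels, and the usual duality $\overline{\alpha}$. An interface $I$ gives a multiplicity in $\mathbb N\cup\{\infty\}$ to finitely many pairs $a:\alpha$; interfaces are added ($\uplus$) and compared ($\sqsubseteq$) pointwise. $\Gamma$ gives basic types to value variables and pairs $\langle\alpha_q,\overline\alpha_{q'}\rangle$, $q,q'\in\{\mathsf{lin},\mathsf{un}\}$, to service names; $\Theta$ gives interfaces to process variables and locations. A typing $\Delta$ is a finite set of assignments $k:\alpha$ (at most one for each $k$) and bracketed assignments $[\kappa^p:\alpha]$ for distinct restricted channels; $|\Delta|$ is the number of its assignments of both sorts, and $,$ and $\cup$ below are disjoint. The judgment $\Gamma;\Theta\vdash P\triangleright\Delta;I$ is inductively defined by: - $\mathbf 0\triangleright\emptyset;\emptyset$; $\ \mathsf X\triangleright\emptyset;\Theta(\mathsf X)$; if $P_i\triangleright\Delta_i;I_i$ for $i=1,2$, then $P_1|P_2\triangleright\Delta_1\cup\Delta_2;I_1\uplus I_2$; - if $P\triangleright\Delta,x:\alpha;I$ and $\Gamma(a)=\langle\alpha_{\mathsf{lin}},\overline\alpha_{\mathsf{lin}}\rangle$, then $\mathsf{acc}\,a(x).P\triangleright\Delta;I\uplus\langle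 a:\alpha,1\rangle$; if $P\triangleright\Delta,x:\overline\alpha;I$ and $\Gamma(a)=\langle\alpha_q,\overline\alpha_{\mathsf{lin}}\rangle$, then $\mathsf{req}\,a(x).P\triangleright\Delta;I\uplus\langle a:\overline\alpha,1\rangle$; if $P\triangleright x:\alpha;I$ and $\Gamma(a)=\langle\alpha_{\mathsf{un}},\overline\alpha_{\mathsf{lin}}\rangle$, then ${!}\mathsf{acc}\,a(x).P\triangleright\emptyset;\infty\cdot I\uplus\langle a:\alpha,\infty\rangle$; - if $P\triangleright\Delta;I'$, $h=|\Delta|$ and $I'\sqsubseteq\Theta(l)$, then $l^{h}[P]\triangleright\Delta;I'$; if $\Gamma;\Theta,\mathsf X:\Theta(l)\vdash P\triangleright\emptyset;I'$, then $l\{(\mathsf X).P\}\triangleright\emptyset;\emptyset$; - if $P\triangleright\Delta,k:\alpha;I$ and $\Gamma\vdash\tilde e:\tilde\tau$, then $k\langle\tilde e\rangle.P\triangleright\Delta,k:{!}(\tilde\tau).\alpha;I$; if $\Gamma,\tilde x:\tilde\tau;\Theta\vdash P\triangleright\Delta,k:\alpha;I$, then $k(\tilde x).P\triangleright\Delta,k:{?}(\tilde\tau).\alpha;I$;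 - if $P\triangleright\Delta,k:\alpha;I$, then $k\langle\!\langle k'\rangle\!\rangle.P\triangleright\Delta,k:{!}(\beta).\alpha,k':\beta;I$; if $P\triangleright\Delta,k:\alpha,x:\beta;I$, then $k(\!(x)\!).P\triangleright\Delta,k:{?}(\beta).\alpha;I$; - if $P_i\triangleright\Delta,k:\alpha_i;I_i$ and $I_i\sqsubseteq I$ for all $i$, then $k\triangleright\{n_i{:}P_i\}_i\triangleright\Delta,k:\&\{n_i:\alpha_i\}_i;I$; if $P\triangleright\Delta,k:\alpha_j;I$, then $k\triangleleft n_j;P\triangleright\Delta,k:\oplus\{n_i:\alpha_i\}_i;I$; - if $\Gamma\vdash e:\mathsf{bool}$, $P\triangleright\Delta;I_1$, $Q\triangleright\Delta;I_2$ and $I_1,I_2\sqsubseteq I$, then $\mathsf{if}\ e\ \mathsf{then}\ P\ \mathsf{else}\ Q\triangleright\Delta;I$; if $P\triangleright\Delta;I$ and $k\notin\mathrm{dom}\,\Delta$, then $\mathsf{close}(k).P\triangleright\Delta,k:\epsilon;I$; - if $P\triangleright\Delta,\kappa^-:\alpha,\kappa^+:\overline\alpha;I$, then $(\nu\kappa)P\triangleright\Delta,[\kappa^-:\alpha],[\kappa^+:\overline\alpha];I$;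 if $P\triangleright\Delta;I$ and $\kappa^+,\kappa^-\notin\mathrm{dom}\,\Delta$, then $(\nu\kappa)P\triangleright\Delta;I$. $\Delta$ is *balanced* if $\kappa^p:\alpha\in\Delta$ implies $\kappa^{\overline p}:\overline\alpha\in\Delta$, and likewise for bracketed assignments. *Consistency.* A process *contains a $\kappa$-redex* if, enclosed only in locations, parallel compositions and restrictions, it has two parallel subprocesses that are prefixed on $\kappa^p$ and on $\kappa^{\overline p}$, respectively, by complementary actions: output and input of tuples of equal length, delegation and reception of a session, selection of a label and branching that offers it, or closing and closing. A process $P$ is *update-consistent* if for all $P'$ and $\kappa$ such that $P\to^{*}P'$ and $P'$ contains a $\kappa$-redex, if $P'\to_{\mathrm{upd}}P''$ then $P''$ contains a $\kappa$-redex. Here $\kappa$ may be free or restricted. As restricted names can be renamed, for these it is required that a redex on some restricted channel remains, and moreover that the same channel keeps a redex: whenever $P\to^{*}P'\equiv(\nu\kappa_1)\cdots(\nu\kappa_n)R$, the process $R$ contains a $\kappa$-redex with $\kappa$ free in $R$, and $R\to_{\mathrm{upd}}R''$, then $R''$ contains a $\kappa$-redex. **Claim.** If $\Gamma;\Theta\vdash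 P\triangleright\Delta;I$ with $\Delta$ balanced, then $P$ is update-consistent. -/

import Mathlib

/-!
A session pi-calculus with located processes and update processes, its reduction semantics
and its session type system.

Binding is represented by de Bruijn indices, so that alpha-equivalent processes are equal.
There are four independent index spaces: session variables (bound by session acceptance,
session request and session reception), value variables (bound by value reception),
session channels (bound by restriction) and process variables (bound by update processes).
Service names, labels and locations are never bound; they are natural numbers.
-/

namespace AdaptableSessions

noncomputable section

/-! ### Expressions -/

/-- Literal constants. -/
inductive Lit where
  | int (z : ℤ)
  | bool (b : Bool)
  | str (s : String)

/-- Constants: literals, and names standing for values (value variables). -/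
inductive Const where
  | lit (c : Lit)
  | name (i : ℕ)

inductive BinOp where
  | add | sub | mul | le | eq | and | or

inductive Expr where
  | const (c : Const)
  | bin (o : BinOp) (e₁ e₂ : Expr)

/-- The (partial) meaning of the operators on literals. -/
def BinOp.eval : BinOp → Lit → Lit → Option Lit
  | .add, .int x, .int y => some (.int (x + y))
  | .sub, .int x, .int y => some (.int (x - y))
  | .mul, .int x, .int y => some (.int (x * y))
  | .le, .int x, .int y => some (.bool (decide (x ≤ y)))
  | .eq, .int x, .int y => some (.bool (decide (x = y)))
  | .eq, .bool x, .bool y => some (.bool (decide (x = y)))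
  | .eq, .str x, .str y => some (.bool (decide (x = y)))
  | .and, .bool x, .bool y => some (.bool (x && y))
  | .or, .bool x, .bool y => some (.bool (x || y))
  | _, _, _ => none

/-- The evaluation relation `e ↓ c`. -/
inductive Eval : Expr → Const → Prop where
  | const (c : Const) : Eval (.const c) c
  | bin {o : BinOp} {e₁ e₂ : Expr} {c₁ c₂ c : Lit} :
      Eval e₁ (.lit c₁) → Eval e₂ (.lit c₂) → o.eval c₁ c₂ = some c →
      Eval (.bin o e₁ e₂) (.lit c)

/-! ### Processes -/

/-- Polarities of the two endpoints of a session channel. -/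
inductive Pol where
  | pos | neg

def Pol.dual : Pol → Pol
  | .pos => .neg
  | .neg => .pos

/-- The session subjects `k`: a session variable `x` or a polarized channel `κ^p`. -/
inductive Sess where
  | svar (i : ℕ)
  | chan (p : Pol) (i : ℕ)

inductive Proc where
  /-- inactive process -/
  | nil
  /-- parallel composition -/
  | par (P Q : Proc)
  /-- restriction of a session channel (binds channel `0`) -/
  | res (P : Proc)
  /-- session acceptance on service `a` (binds session variable `0`) -/
  | accept (a : ℕ) (P : Proc)
  /-- replicated session acceptance on service `a` (binds session variable `0`) -/
  | repAccept (a : ℕ) (P : Proc)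
  /-- session request on service `a` (binds session variable `0`) -/
  | request (a : ℕ) (P : Proc)
  /-- located process `l^h[P]`; the integer `h` is the run-time annotation -/
  | loc (l : ℕ) (h : ℤ) (P : Proc)
  /-- process variable -/
  | pvar (X : ℕ)
  /-- update process for location `l` (binds process variable `0`) -/
  | adapt (l : ℕ) (P : Proc)
  /-- output of a tuple of expressions -/
  | send (k : Sess) (es : List Expr) (P : Proc)
  /-- input of an `n`-tuple (binds value variables `0, …, n - 1`) -/
  | recv (k : Sess) (n : ℕ) (P : Proc)
  /-- delegation of the session endpoint `k'` -/
  | sendSess (k k' : Sess) (P : Proc)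
  /-- reception of a session endpoint (binds session variable `0`) -/
  | recvSess (k : Sess) (P : Proc)
  /-- offer of `m + 1` labelled alternatives -/
  | branch (k : Sess) (m : ℕ) (lab : Fin (m + 1) → ℕ) (P : Fin (m + 1) → Proc)
  /-- selection of a label -/
  | select (k : Sess) (n : ℕ) (P : Proc)
  /-- conditional -/
  | cond (e : Expr) (P Q : Proc)
  /-- session closing -/
  | close (k : Sess) (P : Proc)

/-! ### Substitution -/

/-- A simultaneous substitution of session subjects for session variables, of channels for
channels, and of constants for value variables. -/
structure Sub where
  sess : ℕ → Sess
  chan : ℕ → ℕ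
  val : ℕ → Const

def Sess.sub (σ : Sub) : Sess → Sess
  | .svar i => σ.sess i
  | .chan p i => .chan p (σ.chan i)

def Const.sub (σ : Sub) : Const → Const
  | .lit c => .lit c
  | .name i => σ.val i

def Expr.sub (σ : Sub) : Expr → Expr
  | .const c => .const (c.sub σ)
  | .bin o e₁ e₂ => .bin o (e₁.sub σ) (e₂.sub σ)

def Sub.id : Sub := ⟨Sess.svar, fun i => i, Const.name⟩

/-- Weakening by one session variable. -/
def Sub.wkS : Sub := { Sub.id with sess := fun i => .svar (i + 1) }

/-- Weakening by one channel. -/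
def Sub.wkC : Sub := { Sub.id with chan := fun i => i + 1 }

/-- Weakening by `n` value variables. -/
def Sub.wkV (n : ℕ) : Sub := { Sub.id with val := fun i => .name (i + n) }

/-- Exchange of the two innermost channels. -/
def Sub.swapC : Sub :=
  { Sub.id with chan := fun i => if i = 0 then 1 else if i = 1 then 0 else i }

/-- Passing under a binder of a session variable. -/
def Sub.liftS (σ : Sub) : Sub :=
  { σ with sess := fun i => match i with
      | 0 => .svar 0
      | i + 1 => (σ.sess i).sub Sub.wkS }

/-- Passing under a restriction. -/
def Sub.liftC (σ : Sub) : Sub :=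
  { σ with
    sess := fun i => (σ.sess i).sub Sub.wkC
    chan := fun i => match i with
      | 0 => 0
      | i + 1 => σ.chan i + 1 }

/-- Passing under a binder of `n` value variables. -/
def Sub.liftV (n : ℕ) (σ : Sub) : Sub :=
  { σ with val := fun i => if i < n then .name i else (σ.val (i - n)).sub (Sub.wkV n) }

def Proc.sub : Sub → Proc → Proc
  | _, .nil => .nil
  | σ, .par P Q => .par (P.sub σ) (Q.sub σ)
  | σ, .res P => .res (P.sub σ.liftC)
  | σ, .accept a P => .accept a (P.sub σ.liftS)
  | σ, .repAccept a P => .repAccept a (P.sub σ.liftS)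
  | σ, .request a P => .request a (P.sub σ.liftS)
  | σ, .loc l h P => .loc l h (P.sub σ)
  | _, .pvar X => .pvar X
  | σ, .adapt l P => .adapt l (P.sub σ)
  | σ, .send k es P => .send (k.sub σ) (es.map (Expr.sub σ)) (P.sub σ)
  | σ, .recv k n P => .recv (k.sub σ) n (P.sub (σ.liftV n))
  | σ, .sendSess k k' P => .sendSess (k.sub σ) (k'.sub σ) (P.sub σ)
  | σ, .recvSess k P => .recvSess (k.sub σ) (P.sub σ.liftS)
  | σ, .branch k m lab P => .branch (k.sub σ) m lab (fun i => (P i).sub σ)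
  | σ, .select k n P => .select (k.sub σ) n (P.sub σ)
  | σ, .cond e P Q => .cond (e.sub σ) (P.sub σ) (Q.sub σ)
  | σ, .close k P => .close (k.sub σ) (P.sub σ)

/-- Renaming of process variables. -/
def Proc.renP : (ℕ → ℕ) → Proc → Proc
  | _, .nil => .nil
  | f, .par P Q => .par (P.renP f) (Q.renP f)
  | f, .res P => .res (P.renP f)
  | f, .accept a P => .accept a (P.renP f)
  | f, .repAccept a P => .repAccept a (P.renP f)
  | f, .request a P => .request a (P.renP f)
  | f, .loc l h P => .loc l h (P.renP f)
  | f, .pvar X => .pvar (f X)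
  | f, .adapt l P => .adapt l (P.renP fun i => match i with
      | 0 => 0
      | i + 1 => f i + 1)
  | f, .send k es P => .send k es (P.renP f)
  | f, .recv k n P => .recv k n (P.renP f)
  | f, .sendSess k k' P => .sendSess k k' (P.renP f)
  | f, .recvSess k P => .recvSess k (P.renP f)
  | f, .branch k m lab P => .branch k m lab (fun i => (P i).renP f)
  | f, .select k n P => .select k n (P.renP f)
  | f, .cond e P Q => .cond e (P.renP f) (Q.renP f)
  | f, .close k P => .close k (P.renP f)

/-- Capture-avoiding substitution of processes for process variables. -/
def Proc.subP : (ℕ → Proc) → Proc → Proc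
  | _, .nil => .nil
  | θ, .par P Q => .par (P.subP θ) (Q.subP θ)
  | θ, .res P => .res (P.subP fun i => (θ i).sub Sub.wkC)
  | θ, .accept a P => .accept a (P.subP fun i => (θ i).sub Sub.wkS)
  | θ, .repAccept a P => .repAccept a (P.subP fun i => (θ i).sub Sub.wkS)
  | θ, .request a P => .request a (P.subP fun i => (θ i).sub Sub.wkS)
  | θ, .loc l h P => .loc l h (P.subP θ)
  | θ, .pvar X => θ X
  | θ, .adapt l P => .adapt l (P.subP fun i => match i with
      | 0 => .pvar 0
      | i + 1 => (θ i).renP Nat.succ)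
  | θ, .send k es P => .send k es (P.subP θ)
  | θ, .recv k n P => .recv k n (P.subP fun i => (θ i).sub (Sub.wkV n))
  | θ, .sendSess k k' P => .sendSess k k' (P.subP θ)
  | θ, .recvSess k P => .recvSess k (P.subP fun i => (θ i).sub Sub.wkS)
  | θ, .branch k m lab P => .branch k m lab (fun i => (P i).subP θ)
  | θ, .select k n P => .select k n (P.subP θ)
  | θ, .cond e P Q => .cond e (P.subP θ) (Q.subP θ)
  | θ, .close k P => .close k (P.subP θ)

/-- `P{k/x}` for the session variable `x` with index `0`. -/
def Proc.instS (k : Sess) (P : Proc) : Proc :=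
  P.sub { Sub.id with sess := fun i => match i with
      | 0 => k
      | i + 1 => .svar i }

/-- `P{κ^p/x}` for the session variable `x` with index `0` and a new channel `κ`, which gets
the channel index `0`; the other channels are weakened. -/
def Proc.instNew (p : Pol) (P : Proc) : Proc :=
  P.sub { Sub.id with
    sess := fun i => match i with
      | 0 => .chan p 0
      | i + 1 => .svar i
    chan := fun i => i + 1 }

/-- `P{c₁,…,cₙ/x₁,…,xₙ}` for the value variables with indices `0, …, n - 1`. -/
def Proc.instV (cs : List Const) (P : Proc) : Proc :=
  P.sub { Sub.id with val := fun i => cs.getD i (.name (i - cs.length)) }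

/-- `P{Q/X}` for the process variable `X` with index `0`. -/
def Proc.instP (P Q : Proc) : Proc :=
  P.subP fun i => match i with
    | 0 => Q
    | i + 1 => .pvar i

/-! ### Structural congruence -/

/-- Structural congruence: the least congruence that makes parallel composition a commutative
monoid and allows the usual laws of restriction, including scope extrusion over parallel
composition and over (transparent) locations. -/
inductive Cong : Proc → Proc → Prop where
  | refl (P : Proc) : Cong P P
  | symm {P Q : Proc} : Cong P Q → Cong Q P
  | trans {P Q R : Proc} : Cong P Q → Cong Q R → Cong P R
  | parComm (P Q : Proc) : Cong (.par P Q) (.par Q P)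
  | parAssoc (P Q R : Proc) : Cong (.par (.par P Q) R) (.par P (.par Q R))
  | parNil (P : Proc) : Cong (.par P .nil) P
  | resNil : Cong (.res .nil) .nil
  | resSwap (P : Proc) : Cong (.res (.res P)) (.res (.res (P.sub Sub.swapC)))
  | resPar (P Q : Proc) : Cong (.par (.res P) Q) (.res (.par P (Q.sub Sub.wkC)))
  | resLoc (l : ℕ) (h : ℤ) (P : Proc) : Cong (.loc l h (.res P)) (.res (.loc l h P))
  | par {P P' Q Q' : Proc} : Cong P P' → Cong Q Q' → Cong (.par P Q) (.par P' Q')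
  | res {P P' : Proc} : Cong P P' → Cong (.res P) (.res P')
  | accept {P P' : Proc} (a : ℕ) : Cong P P' → Cong (.accept a P) (.accept a P')
  | repAccept {P P' : Proc} (a : ℕ) : Cong P P' → Cong (.repAccept a P) (.repAccept a P')
  | request {P P' : Proc} (a : ℕ) : Cong P P' → Cong (.request a P) (.request a P')
  | loc {P P' : Proc} (l : ℕ) (h : ℤ) : Cong P P' → Cong (.loc l h P) (.loc l h P')
  | adapt {P P' : Proc} (l : ℕ) : Cong P P' → Cong (.adapt l P) (.adapt l P')
  | send {P P' : Proc} (k : Sess) (es : List Expr) :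
      Cong P P' → Cong (.send k es P) (.send k es P')
  | recv {P P' : Proc} (k : Sess) (n : ℕ) : Cong P P' → Cong (.recv k n P) (.recv k n P')
  | sendSess {P P' : Proc} (k k' : Sess) :
      Cong P P' → Cong (.sendSess k k' P) (.sendSess k k' P')
  | recvSess {P P' : Proc} (k : Sess) : Cong P P' → Cong (.recvSess k P) (.recvSess k P')
  | branch (k : Sess) (m : ℕ) (lab : Fin (m + 1) → ℕ) {P P' : Fin (m + 1) → Proc} :
      (∀ i, Cong (P i) (P' i)) → Cong (.branch k m lab P) (.branch k m lab P')
  | select {P P' : Proc} (k : Sess) (n : ℕ) :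
      Cong P P' → Cong (.select k n P) (.select k n P')
  | cond {P P' Q Q' : Proc} (e : Expr) :
      Cong P P' → Cong Q Q' → Cong (.cond e P Q) (.cond e P' Q')
  | close {P P' : Proc} (k : Sess) : Cong P P' → Cong (.close k P) (.close k P')

/-! ### Reduction -/

/-- Contexts `C ::= • | l^h[C ∣ P]`. -/
inductive Ctx where
  | hole
  | loc (l : ℕ) (h : ℤ) (C : Ctx) (P : Proc)

def Ctx.fill : Ctx → Proc → Proc
  | .hole, Q => Q
  | .loc l h C P, Q => .loc l h (.par (C.fill Q) P)

/-- Addition of `d` to all annotations on the path to the hole: `C⁺`, `C⁺⁺`, `C⁻`, `C⁻⁻` are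
`C.bump 1`, `C.bump 2`, `C.bump (-1)`, `C.bump (-2)`. -/
def Ctx.bump (d : ℤ) : Ctx → Ctx
  | .hole => .hole
  | .loc l h C P => .loc l (h + d) (C.bump d) P

/-- Weakening of a context by a channel. -/
def Ctx.wkC : Ctx → Ctx
  | .hole => .hole
  | .loc l h C P => .loc l h C.wkC (P.sub Sub.wkC)

/-- The update rule. -/
inductive UpdRule : Proc → Proc → Prop where
  | upd (E C D : Ctx) (l : ℕ) (P Q : Proc) :
      UpdRule (E.fill (.par (C.fill (.loc l 0 Q)) (D.fill (.adapt l P))))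
        (E.fill (.par (C.fill (P.instP Q)) (D.fill .nil)))

/-- The other reduction rules. -/
inductive CommRule : Proc → Proc → Prop where
  | opn (E C D : Ctx) (a : ℕ) (P Q : Proc) :
      CommRule (E.fill (.par (C.fill (.accept a P)) (D.fill (.request a Q))))
        ((E.bump 2).fill (.res (.par ((C.wkC.bump 1).fill (P.instNew .pos))
          ((D.wkC.bump 1).fill (Q.instNew .neg)))))
  | ropn (E C D : Ctx) (a : ℕ) (P Q : Proc) :
      CommRule (E.fill (.par (C.fill (.repAccept a P)) (D.fill (.request a Q))))
        ((E.bump 2).fill (.res (.par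
          ((C.wkC.bump 1).fill (.par (P.instNew .pos) ((Proc.repAccept a P).sub Sub.wkC)))
          ((D.wkC.bump 1).fill (Q.instNew .neg)))))
  | io (E C D : Ctx) (p : Pol) (i n : ℕ) (es : List Expr) (cs : List Const) (P Q : Proc) :
      List.Forall₂ Eval es cs → cs.length = n →
      CommRule
        (E.fill (.par (C.fill (.send (.chan p i) es P)) (D.fill (.recv (.chan p.dual i) n Q))))
        (E.fill (.par (C.fill P) (D.fill (Q.instV cs))))
  | pass (E C D : Ctx) (p q : Pol) (i j : ℕ) (P Q : Proc) :
      CommRule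
        (E.fill (.par (C.fill (.sendSess (.chan p i) (.chan q j) P))
          (D.fill (.recvSess (.chan p.dual i) Q))))
        (E.fill (.par ((C.bump (-1)).fill P) ((D.bump 1).fill (Q.instS (.chan q j)))))
  | sel (E C D : Ctx) (p : Pol) (i m : ℕ) (lab : Fin (m + 1) → ℕ) (P : Fin (m + 1) → Proc)
      (j : Fin (m + 1)) (Q : Proc) :
      CommRule
        (E.fill (.par (C.fill (.branch (.chan p i) m lab P))
          (D.fill (.select (.chan p.dual i) (lab j) Q))))
        (E.fill (.par (C.fill (P j)) (D.fill Q)))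
  | close (E C D : Ctx) (p : Pol) (i : ℕ) (P Q : Proc) :
      CommRule
        (E.fill (.par (C.fill (.close (.chan p i) P)) (D.fill (.close (.chan p.dual i) Q))))
        ((E.bump (-2)).fill (.par ((C.bump (-1)).fill P) ((D.bump (-1)).fill Q)))
  | ifTrue (C : Ctx) (e : Expr) (P Q : Proc) :
      Eval e (.lit (.bool true)) → CommRule (C.fill (.cond e P Q)) (C.fill P)
  | ifFalse (C : Ctx) (e : Expr) (P Q : Proc) :
      Eval e (.lit (.bool false)) → CommRule (C.fill (.cond e P Q)) (C.fill Q)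

/-- Closure of a set of reduction rules under structural congruence, parallel composition and
restriction. -/
inductive RedClosure (B : Proc → Proc → Prop) : Proc → Proc → Prop where
  | base {P Q : Proc} : B P Q → RedClosure B P Q
  | str {P P' Q' Q : Proc} : Cong P P' → RedClosure B P' Q' → Cong Q' Q → RedClosure B P Q
  | par {P P' : Proc} (Q : Proc) : RedClosure B P P' → RedClosure B (.par P Q) (.par P' Q)
  | res {P P' : Proc} : RedClosure B P P' → RedClosure B (.res P) (.res P')

/-- Reduction. -/
def Red : Proc → Proc → Prop := RedClosure fun P Q => UpdRule P Q ∨ CommRule P Q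

/-- Update actions: reductions inferred using the update rule. -/
def UpdRed : Proc → Proc → Prop := RedClosure UpdRule

/-! ### Types -/

/-- Basic types. -/
inductive BTy where
  | int | bool | str

/-- Session types. -/
inductive STy where
  | send (τs : List BTy) (α : STy)
  | recv (τs : List BTy) (α : STy)
  | sendSess (β α : STy)
  | recvSess (β α : STy)
  | branch (m : ℕ) (lab : Fin (m + 1) → ℕ) (α : Fin (m + 1) → STy)
  | select (m : ℕ) (lab : Fin (m + 1) → ℕ) (α : Fin (m + 1) → STy)
  | done

/-- Duality. -/
def STy.dual : STy → STy
  | .send τs α => .recv τs α.dual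
  | .recv τs α => .send τs α.dual
  | .sendSess β α => .recvSess β α.dual
  | .recvSess β α => .sendSess β α.dual
  | .branch m lab α => .select m lab (fun i => (α i).dual)
  | .select m lab α => .branch m lab (fun i => (α i).dual)
  | .done => .done

/-- Type qualifiers. -/
inductive Qual where
  | lin | un

/-- Interfaces: each pair of a service name and a session type is given a multiplicity, which
is infinite for the unrestricted (persistent) services. The union of interfaces is addition,
the preorder is the pointwise order, `Finsupp.single (a, α) h` is `⟨a : α, h⟩`. -/
abbrev Interface := ℕ × STy →₀ ℕ∞

/-- First-order environments: `vars` lists the basic types of the value variables, and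
`serv a = some (α, q, q')` stands for `a : ⟨α_q, dual(α)_q'⟩`. -/
structure Gamma where
  vars : List BTy
  serv : ℕ → Option (STy × Qual × Qual)

/-- Higher-order environments: interfaces of process variables and of locations. -/
structure Theta where
  pvars : List Interface
  locs : ℕ → Option Interface

/-- Assignments: `act k α` is `k : α`, and `brk p α` is `[κ^p : α]`, where `κ` is a channel that
is restricted in the typed process (its name is immaterial and has no index outside of the
restriction). -/
inductive Assign where
  | act (k : Sess) (α : STy)
  | brk (p : Pol) (α : STy)

def Assign.sub (σ : Sub) : Assign → Assign
  | .act k α => .act (k.sub σ) α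
  | .brk p α => .brk p α

/-- Typings `Δ`. -/
abbrev Typing := Multiset Assign

def Typing.sub (σ : Sub) (Δ : Typing) : Typing := Multiset.map (Assign.sub σ) Δ

/-- `k ∈ dom Δ`. -/
def Typing.Dom (Δ : Typing) (k : Sess) : Prop := ∃ α, Assign.act k α ∈ Δ

/-- A typing is balanced if with each assignment it has the dual one for the other endpoint. -/
def Balanced (Δ : Typing) : Prop :=
  (∀ p i α, Assign.act (.chan p i) α ∈ Δ → Assign.act (.chan p.dual i) α.dual ∈ Δ) ∧
  (∀ p α, Assign.brk p α ∈ Δ → Assign.brk p.dual α.dual ∈ Δ)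

/-! ### Typing rules -/

def Lit.ty : Lit → BTy
  | .int _ => .int
  | .bool _ => .bool
  | .str _ => .str

/-- Types of the operators. -/
inductive BinOp.HasTy : BinOp → BTy → BTy → BTy → Prop where
  | add : HasTy .add .int .int .int
  | sub : HasTy .sub .int .int .int
  | mul : HasTy .mul .int .int .int
  | le : HasTy .le .int .int .bool
  | eq (τ : BTy) : HasTy .eq τ τ .bool
  | and : HasTy .and .bool .bool .bool
  | or : HasTy .or .bool .bool .bool

/-- Typing of expressions. -/
inductive ExprTyped (Γ : Gamma) : Expr → BTy → Prop where
  | lit (c : Lit) : ExprTyped Γ (.const (.lit c)) c.ty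
  | name (i : ℕ) (τ : BTy) : Γ.vars[i]? = some τ → ExprTyped Γ (.const (.name i)) τ
  | bin {o : BinOp} {e₁ e₂ : Expr} {τ₁ τ₂ τ : BTy} :
      ExprTyped Γ e₁ τ₁ → ExprTyped Γ e₂ τ₂ → o.HasTy τ₁ τ₂ τ → ExprTyped Γ (.bin o e₁ e₂) τ

/-- The judgment `Γ; Θ ⊢ P ▷ Δ; I`. -/
inductive Typed : Gamma → Theta → Proc → Typing → Interface → Prop where
  | nil (Γ : Gamma) (Θ : Theta) : Typed Γ Θ .nil 0 0
  | pvar (Γ : Gamma) (Θ : Theta) (X : ℕ) (I : Interface) :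
      Θ.pvars[X]? = some I → Typed Γ Θ (.pvar X) 0 I
  | accept {Γ : Gamma} {Θ : Theta} {a : ℕ} {α : STy} {P : Proc} {Δ : Typing} {I : Interface} :
      Γ.serv a = some (α, .lin, .lin) →
      Typed Γ Θ P (Assign.act (.svar 0) α ::ₘ Δ.sub Sub.wkS) I →
      Typed Γ Θ (.accept a P) Δ (I + Finsupp.single (a, α) 1)
  | repAccept {Γ : Gamma} {Θ : Theta} {a : ℕ} {α : STy} {P : Proc} {I : Interface} :
      Γ.serv a = some (α, .un, .lin) →
      Typed Γ Θ P {Assign.act (.svar 0) α} I →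
      Typed Γ Θ (.repAccept a P) 0 ((⊤ : ℕ∞) • I + Finsupp.single (a, α) ⊤)
  | request {Γ : Gamma} {Θ : Theta} {a : ℕ} {α : STy} {q : Qual} {P : Proc} {Δ : Typing}
      {I : Interface} :
      Γ.serv a = some (α, q, .lin) →
      Typed Γ Θ P (Assign.act (.svar 0) α.dual ::ₘ Δ.sub Sub.wkS) I →
      Typed Γ Θ (.request a P) Δ (I + Finsupp.single (a, α.dual) 1)
  | loc {Γ : Gamma} {Θ : Theta} {l : ℕ} {h : ℤ} {P : Proc} {Δ : Typing} {I I' : Interface} :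
      Θ.locs l = some I → Typed Γ Θ P Δ I' → h = (Multiset.card Δ : ℤ) → I' ≤ I →
      Typed Γ Θ (.loc l h P) Δ I'
  | adapt {Γ : Gamma} {Θ : Theta} {l : ℕ} {P : Proc} {I I' : Interface} :
      Θ.locs l = some I → Typed Γ { Θ with pvars := I :: Θ.pvars } P 0 I' →
      Typed Γ Θ (.adapt l P) 0 0
  | send {Γ : Gamma} {Θ : Theta} {k : Sess} {es : List Expr} {τs : List BTy} {α : STy}
      {P : Proc} {Δ : Typing} {I : Interface} :
      List.Forall₂ (ExprTyped Γ) es τs → ¬ Δ.Dom k →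
      Typed Γ Θ P (Assign.act k α ::ₘ Δ) I →
      Typed Γ Θ (.send k es P) (Assign.act k (.send τs α) ::ₘ Δ) I
  | recv {Γ : Gamma} {Θ : Theta} {k : Sess} {τs : List BTy} {α : STy}
      {P : Proc} {Δ : Typing} {I : Interface} :
      ¬ Δ.Dom k →
      Typed { Γ with vars := τs ++ Γ.vars } Θ P (Assign.act k α ::ₘ Δ) I →
      Typed Γ Θ (.recv k τs.length P) (Assign.act k (.recv τs α) ::ₘ Δ) I
  | sendSess {Γ : Gamma} {Θ : Theta} {k k' : Sess} {α β : STy}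
      {P : Proc} {Δ : Typing} {I : Interface} :
      k ≠ k' → ¬ Δ.Dom k → ¬ Δ.Dom k' →
      Typed Γ Θ P (Assign.act k α ::ₘ Δ) I →
      Typed Γ Θ (.sendSess k k' P) (Assign.act k (.sendSess β α) ::ₘ Assign.act k' β ::ₘ Δ) I
  | recvSess {Γ : Gamma} {Θ : Theta} {k : Sess} {α β : STy}
      {P : Proc} {Δ : Typing} {I : Interface} :
      ¬ Δ.Dom k →
      Typed Γ Θ P
        (Assign.act (.svar 0) β ::ₘ Assign.act (k.sub Sub.wkS) α ::ₘ Δ.sub Sub.wkS) I →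
      Typed Γ Θ (.recvSess k P) (Assign.act k (.recvSess β α) ::ₘ Δ) I
  /-- The labels of a type are distinct; the order of the alternatives is irrelevant. -/
  | branch {Γ : Gamma} {Θ : Theta} {k : Sess} {m : ℕ} {lab labP : Fin (m + 1) → ℕ}
      {α : Fin (m + 1) → STy} {P : Fin (m + 1) → Proc} {Δ : Typing}
      {J : Fin (m + 1) → Interface} {I : Interface} (π : Equiv.Perm (Fin (m + 1))) :
      Function.Injective lab → (∀ i, labP i = lab (π i)) → ¬ Δ.Dom k →
      (∀ i, Typed Γ Θ (P i) (Assign.act k (α (π i)) ::ₘ Δ) (J i)) → (∀ i, J i ≤ I) →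
      Typed Γ Θ (.branch k m labP P) (Assign.act k (.branch m lab α) ::ₘ Δ) I
  | select {Γ : Gamma} {Θ : Theta} {k : Sess} {m : ℕ} {lab : Fin (m + 1) → ℕ}
      {α : Fin (m + 1) → STy} {P : Proc} {Δ : Typing} {I : Interface} (j : Fin (m + 1)) :
      Function.Injective lab → ¬ Δ.Dom k →
      Typed Γ Θ P (Assign.act k (α j) ::ₘ Δ) I →
      Typed Γ Θ (.select k (lab j) P) (Assign.act k (.select m lab α) ::ₘ Δ) I
  | cond {Γ : Gamma} {Θ : Theta} {e : Expr} {P Q : Proc} {Δ : Typing} {I₁ I₂ I : Interface} :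
      ExprTyped Γ e .bool → Typed Γ Θ P Δ I₁ → Typed Γ Θ Q Δ I₂ → I₁ ≤ I → I₂ ≤ I →
      Typed Γ Θ (.cond e P Q) Δ I
  | close {Γ : Gamma} {Θ : Theta} {k : Sess} {P : Proc} {Δ : Typing} {I : Interface} :
      ¬ Δ.Dom k → Typed Γ Θ P Δ I →
      Typed Γ Θ (.close k P) (Assign.act k .done ::ₘ Δ) I
  | par {Γ : Gamma} {Θ : Theta} {P Q : Proc} {Δ₁ Δ₂ : Typing} {I₁ I₂ : Interface} :
      (∀ k, Δ₁.Dom k → ¬ Δ₂.Dom k) → Typed Γ Θ P Δ₁ I₁ → Typed Γ Θ Q Δ₂ I₂ →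
      Typed Γ Θ (.par P Q) (Δ₁ + Δ₂) (I₁ + I₂)
  /-- Restriction of an active session. -/
  | res {Γ : Gamma} {Θ : Theta} {P : Proc} {α : STy} {Δ : Typing} {I : Interface} :
      Typed Γ Θ P (Assign.act (.chan .neg 0) α ::ₘ Assign.act (.chan .pos 0) α.dual ::ₘ
        Δ.sub Sub.wkC) I →
      Typed Γ Θ (.res P) (Assign.brk .neg α ::ₘ Assign.brk .pos α.dual ::ₘ Δ) I
  /-- Restriction of a channel that is not (or no longer) in use. -/
  | resUnused {Γ : Gamma} {Θ : Theta} {P : Proc} {Δ : Typing} {I : Interface} :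
      Typed Γ Θ P (Δ.sub Sub.wkC) I → Typed Γ Θ (.res P) Δ I

/-! ### Consistency -/

/-- The actions of prefixed processes: input and output with their arity, delegation and its
reception, selection with its label, branching with its set of labels, closing. -/
inductive Act where
  | send (n : ℕ)
  | recv (n : ℕ)
  | sendSess
  | recvSess
  | select (n : ℕ)
  | branch (L : Set ℕ)
  | close

/-- Complementary actions. -/
inductive Act.Compl : Act → Act → Prop where
  | symm {a b : Act} : Act.Compl a b → Act.Compl b a
  | io (n : ℕ) : Act.Compl (.send n) (.recv n)
  | pass : Act.Compl .sendSess .recvSess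
  | sel (n : ℕ) (L : Set ℕ) : n ∈ L → Act.Compl (.select n) (.branch L)
  | close : Act.Compl .close .close

/-- `P.HasAct i p a`: the process `P` contains, enclosed only in locations, parallel
compositions and restrictions, a process that is prefixed with the action `a` on the endpoint
`κ^p` of the channel `κ` with index `i` (a `κ`-process). -/
def Proc.HasAct (i : ℕ) (p : Pol) (a : Act) : Proc → Prop
  | .par P Q => P.HasAct i p a ∨ Q.HasAct i p a
  | .loc _ _ P => P.HasAct i p a
  | .res P => P.HasAct (i + 1) p a
  | .send k es _ => k = .chan p i ∧ a = .send es.length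
  | .recv k n _ => k = .chan p i ∧ a = .recv n
  | .sendSess k _ _ => k = .chan p i ∧ a = .sendSess
  | .recvSess k _ => k = .chan p i ∧ a = .recvSess
  | .branch k _ lab _ => k = .chan p i ∧ a = .branch (Set.range lab)
  | .select k n _ => k = .chan p i ∧ a = .select n
  | .close k _ => k = .chan p i ∧ a = .close
  | _ => False

/-- `P` contains a `κ`-redex, for the free channel `κ` with index `i`: two parallel
`κ`-processes, possibly enclosed in contexts, with complementary actions on the two endpoints
of `κ`. -/
def Proc.HasRedex (i : ℕ) : Proc → Prop
  | .par P Q => P.HasRedex i ∨ Q.HasRedex i ∨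
      ∃ p a b, Act.Compl a b ∧ P.HasAct i p a ∧ Q.HasAct i p.dual b
  | .loc _ _ P => P.HasRedex i
  | .res P => P.HasRedex (i + 1)
  | _ => False

/-- `P` contains a `κ`-redex for some channel `κ` that is restricted in `P`. -/
def Proc.HasRestrictedRedex : Proc → Prop
  | .par P Q => P.HasRestrictedRedex ∨ Q.HasRestrictedRedex
  | .loc _ _ P => P.HasRestrictedRedex
  | .res P => P.HasRedex 0 ∨ P.HasRestrictedRedex
  | _ => False

/-- Update consistency: for each process `P'` reachable from `P` that contains a `κ`-redex, all
update actions of `P'` lead to a process that contains a `κ`-redex. This is stated for free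
channels and for restricted channels. Since the name of a restricted channel is immaterial, the
last clause says moreover that it is the redex on the same restricted channel that is preserved:
it concerns all the ways of exposing restrictions of `P'` at top level. -/
def UpdateConsistent (P : Proc) : Prop :=
  ∀ P', Relation.ReflTransGen Red P P' →
    (∀ κ P'', P'.HasRedex κ → UpdRed P' P'' → P''.HasRedex κ) ∧
    (∀ P'', P'.HasRestrictedRedex → UpdRed P' P'' → P''.HasRestrictedRedex) ∧
    (∀ (n : ℕ) (R : Proc), Cong P' (Proc.res^[n] R) →
      ∀ κ R'', R.HasRedex κ → UpdRed R R'' → R''.HasRedex κ)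

end

end AdaptableSessions

/-!
Erase the session types from a typing derivation. What remains says that every session endpoint
on which a process is prefixed is recorded among the endpoints the process uses, and that the
annotation of a location counts the endpoints used inside it. Both facts are invariant under
structural congruence and reduction. An update replaces a process located at `l⁰[Q]`, so `Q` uses
no endpoint; hence nothing in `Q` is prefixed on a channel, and the update cannot remove either
half of a redex.
-/

namespace AdaptableSessions

/-! ### Endpoints used by a process -/

/-- A session endpoint used by a process: `some k` is the session subject `k`, and `none` is an
endpoint of a restricted channel. The latter is anonymous, as in `Assign.brk`. -/
abbrev Endpoint := Option Sess

namespace Endpoint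

/-- Substitution in an endpoint; anonymous endpoints are unaffected. -/
def sub (σ : Sub) : Endpoint → Endpoint := Option.map (Sess.sub σ)

/-- The endpoint as seen from outside a binder of a session variable. The outer `none` means that
the endpoint is the bound variable, which has no name outside. -/
def unbindS : Endpoint → Option Endpoint
  | none => some none
  | some (.svar 0) => none
  | some (.svar (i + 1)) => some (some (.svar i))
  | some (.chan p i) => some (some (.chan p i))

/-- The endpoint as seen from outside a restriction, where the two endpoints of the restricted
channel become anonymous. -/
def unbindC : Endpoint → Endpoint
  | none => none
  | some (.svar i) => some (.svar i)
  | some (.chan _ 0) => none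
  | some (.chan p (i + 1)) => some (.chan p i)

end Endpoint

/-- The session endpoints that a process uses: the typing of a typed process with the session types
erased. A prefix adds an endpoint only where it is the last use of that endpoint, since otherwise
the continuation records it. -/
def Proc.endpoints : Proc → Multiset Endpoint
  | .nil => 0
  | .par P Q => P.endpoints + Q.endpoints
  | .res P => P.endpoints.map Endpoint.unbindC
  | .accept _ P => P.endpoints.filterMap Endpoint.unbindS
  | .repAccept _ _ => 0
  | .request _ P => P.endpoints.filterMap Endpoint.unbindS
  | .loc _ _ P => P.endpoints
  | .pvar _ => 0
  | .adapt _ _ => 0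
  | .send _ _ P => P.endpoints
  | .recv _ _ P => P.endpoints
  | .sendSess _ k' P => some k' ::ₘ P.endpoints
  | .recvSess _ P => P.endpoints.filterMap Endpoint.unbindS
  | .branch _ _ _ P => (P 0).endpoints
  | .select _ _ P => P.endpoints
  | .cond _ P _ => P.endpoints
  | .close k P => some k ::ₘ P.endpoints

/-- The session variable with index `0` is used exactly once, counted as the number of endpoints
that are lost on leaving its scope. -/
def Proc.UsesVarOnce (P : Proc) : Prop :=
  P.endpoints.card = (P.endpoints.filterMap Endpoint.unbindS).card + 1

/-- The invariant of reduction behind update consistency: the annotation of each location is the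
number of endpoints used in it, and bound session variables, the subjects of prefixes and the
alternatives of branchings and conditionals are used as in typed processes. -/
def Proc.WellAnnotated : Proc → Prop
  | .nil => True
  | .par P Q => P.WellAnnotated ∧ Q.WellAnnotated
  | .res P => P.WellAnnotated
  | .accept _ P => P.WellAnnotated ∧ P.UsesVarOnce
  | .repAccept _ P =>
      P.WellAnnotated ∧ P.UsesVarOnce ∧ P.endpoints.filterMap Endpoint.unbindS = 0
  | .request _ P => P.WellAnnotated ∧ P.UsesVarOnce
  | .loc _ h P => P.WellAnnotated ∧ h = (P.endpoints.card : ℤ)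
  | .pvar _ => True
  | .adapt _ P => P.WellAnnotated ∧ P.endpoints = 0
  | .send k _ P => P.WellAnnotated ∧ some k ∈ P.endpoints
  | .recv k _ P => P.WellAnnotated ∧ some k ∈ P.endpoints
  | .sendSess k _ P => P.WellAnnotated ∧ some k ∈ P.endpoints
  | .recvSess k P =>
      P.WellAnnotated ∧ P.UsesVarOnce ∧ some k ∈ P.endpoints.filterMap Endpoint.unbindS
  | .branch k _ _ P =>
      (∀ i, (P i).WellAnnotated ∧ (P i).endpoints = (P 0).endpoints) ∧ some k ∈ (P 0).endpoints
  | .select k _ P => P.WellAnnotated ∧ some k ∈ P.endpoints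
  | .cond _ P Q => P.WellAnnotated ∧ Q.WellAnnotated ∧ Q.endpoints = P.endpoints
  | .close _ P => P.WellAnnotated

/-- A well-annotated process that uses no session endpoint. The bodies of update processes and the
processes that an update may discard are of this kind. -/
structure Proc.Sessionless (P : Proc) : Prop where
  wellAnnotated : P.WellAnnotated
  endpoints_eq_zero : P.endpoints = 0

variable {P P' Q Q' X X' Y Y' : Proc} {σ : Sub}

/-! ### Substitution -/

theorem Sess.sub_liftV (n : ℕ) (σ : Sub) : Sess.sub (σ.liftV n) = Sess.sub σ := by
  funext k; cases k <;> rfl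

namespace Endpoint

theorem sub_some (σ : Sub) (k : Sess) : sub σ (some k) = some (k.sub σ) := rfl

theorem sub_liftV (n : ℕ) (σ : Sub) : sub (σ.liftV n) = sub σ := by
  rw [sub, Sess.sub_liftV, sub]

theorem unbindS_sub_liftS (σ : Sub) (e : Endpoint) :
    unbindS (e.sub σ.liftS) = (unbindS e).map (sub σ) := by
  rcases e with _ | ⟨_ | i⟩ | ⟨p, i⟩ <;> try rfl
  simp only [sub, Option.map_some, Sess.sub, Sub.liftS, unbindS]
  cases σ.sess i <;> rfl

theorem unbindC_sub_liftC (σ : Sub) (e : Endpoint) :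
    unbindC (e.sub σ.liftC) = (unbindC e).sub σ := by
  rcases e with _ | i | ⟨p, _ | i⟩ <;> try rfl
  simp only [sub, Option.map_some, Sess.sub, Sub.liftC, unbindC]
  cases σ.sess i <;> rfl

theorem filterMap_unbindS_map_sub_liftS (σ : Sub) (M : Multiset Endpoint) :
    (M.map (sub σ.liftS)).filterMap unbindS = (M.filterMap unbindS).map (sub σ) := by
  rw [Multiset.filterMap_map, Multiset.map_filterMap]
  exact congrArg (M.filterMap ·) (funext (unbindS_sub_liftS σ))

theorem map_unbindC_map_sub_liftC (σ : Sub) (M : Multiset Endpoint) :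
    (M.map (sub σ.liftC)).map unbindC = (M.map unbindC).map (sub σ) := by
  simp only [Multiset.map_map, Function.comp_def, unbindC_sub_liftC]

theorem some_sub_mem_map_sub {k : Sess} {M : Multiset Endpoint} (h : some k ∈ M) :
    some (k.sub σ) ∈ M.map (sub σ) :=
  Multiset.mem_map_of_mem (sub σ) h

theorem some_sub_mem_map_sub_iff (hσ : Function.Injective (Sess.sub σ)) {k : Sess}
    {M : Multiset Endpoint} : some (k.sub σ) ∈ M.map (sub σ) ↔ some k ∈ M :=
  Multiset.mem_map_of_injective (Option.map_injective hσ) (a := some k)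

theorem map_sub_inj (hσ : Function.Injective (Sess.sub σ)) {M N : Multiset Endpoint} :
    M.map (sub σ) = N.map (sub σ) ↔ M = N :=
  (Multiset.map_injective (Option.map_injective hσ)).eq_iff

end Endpoint

theorem Sess.sub_liftS_injective (hσ : Function.Injective (Sess.sub σ)) :
    Function.Injective (Sess.sub σ.liftS) := by
  intro k k' h
  have hunbind : Endpoint.unbindS (some k) = Endpoint.unbindS (some k') := by
    refine Option.map_injective (Option.map_injective hσ)
      ((Endpoint.unbindS_sub_liftS σ _).symm.trans ?_ |>.trans (Endpoint.unbindS_sub_liftS σ _))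
    rw [Endpoint.sub_some, Endpoint.sub_some, h]
  rcases k with ⟨_ | i⟩ | ⟨p, i⟩ <;> rcases k' with ⟨_ | i'⟩ | ⟨p', i'⟩ <;>
    simp_all [Endpoint.unbindS]

theorem Sess.sub_liftC_injective (hσ : Function.Injective (Sess.sub σ)) :
    Function.Injective (Sess.sub σ.liftC) := by
  intro k k' h
  have hunbind : Endpoint.unbindC (some k) = Endpoint.unbindC (some k') := by
    refine Option.map_injective hσ
      ((Endpoint.unbindC_sub_liftC σ _).symm.trans ?_ |>.trans (Endpoint.unbindC_sub_liftC σ _))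
    rw [Endpoint.sub_some, Endpoint.sub_some, h]
  rcases k with i | ⟨p, _ | i⟩ <;> rcases k' with i' | ⟨p', _ | i'⟩ <;>
    simp_all [Endpoint.unbindC, Sess.sub, Sub.liftC]

namespace Proc

theorem endpoints_sub (P : Proc) (σ : Sub) :
    (P.sub σ).endpoints = P.endpoints.map (Endpoint.sub σ) := by
  induction P generalizing σ <;>
    simp_all [Proc.sub, endpoints, Endpoint.filterMap_unbindS_map_sub_liftS,
      Endpoint.map_unbindC_map_sub_liftC, Endpoint.sub_liftV, Endpoint.sub_some,
      -Multiset.map_map]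

theorem card_endpoints_sub (P : Proc) (σ : Sub) :
    (P.sub σ).endpoints.card = P.endpoints.card := by
  rw [endpoints_sub, Multiset.card_map]

theorem usesVarOnce_sub_liftS (P : Proc) (σ : Sub) :
    (P.sub σ.liftS).UsesVarOnce ↔ P.UsesVarOnce := by
  simp only [UsesVarOnce, endpoints_sub, Endpoint.filterMap_unbindS_map_sub_liftS,
    Multiset.card_map]

theorem WellAnnotated.sub (h : P.WellAnnotated) (σ : Sub) : (P.sub σ).WellAnnotated := by
  induction P generalizing σ <;>
    simp_all [Proc.sub, WellAnnotated, endpoints_sub, usesVarOnce_sub_liftS,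
      Endpoint.filterMap_unbindS_map_sub_liftS, Endpoint.some_sub_mem_map_sub,
      Endpoint.sub_liftV, -Multiset.mem_map, -Multiset.mem_filterMap]

theorem wellAnnotated_sub_iff (hσ : Function.Injective (Sess.sub σ)) :
    (P.sub σ).WellAnnotated ↔ P.WellAnnotated := by
  induction P generalizing σ <;>
    simp_all [Proc.sub, WellAnnotated, endpoints_sub, usesVarOnce_sub_liftS,
      Endpoint.filterMap_unbindS_map_sub_liftS, Endpoint.some_sub_mem_map_sub_iff,
      Endpoint.map_sub_inj, Endpoint.sub_liftV, Sess.sub_liftV, Sess.sub_liftS_injective,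
      Sess.sub_liftC_injective, -Multiset.mem_map, -Multiset.mem_filterMap]

theorem endpoints_renP (P : Proc) (f : ℕ → ℕ) : (P.renP f).endpoints = P.endpoints := by
  induction P generalizing f <;> simp_all [renP, endpoints]

theorem endpoints_subP (P : Proc) {θ : ℕ → Proc} (hθ : ∀ i, (θ i).endpoints = 0) :
    (P.subP θ).endpoints = P.endpoints := by
  induction P generalizing θ <;> simp_all [subP, endpoints, endpoints_sub]

theorem WellAnnotated.renP (h : P.WellAnnotated) (f : ℕ → ℕ) : (P.renP f).WellAnnotated := by
  induction P generalizing f <;>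
    simp_all [Proc.renP, WellAnnotated, endpoints_renP, UsesVarOnce]

theorem sessionless_pvar (i : ℕ) : (Proc.pvar i).Sessionless := ⟨trivial, rfl⟩

theorem Sessionless.sub (h : P.Sessionless) (σ : Sub) : (P.sub σ).Sessionless :=
  ⟨h.1.sub σ, by rw [endpoints_sub, h.2, Multiset.map_zero]⟩

theorem Sessionless.renP (h : P.Sessionless) (f : ℕ → ℕ) : (P.renP f).Sessionless :=
  ⟨h.1.renP f, (endpoints_renP P f).trans h.2⟩

theorem WellAnnotated.subP (h : P.WellAnnotated) {θ : ℕ → Proc} (hθ : ∀ i, (θ i).Sessionless) :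
    (P.subP θ).WellAnnotated := by
  have hsub (σ : Sub) (Q : Proc) {θ : ℕ → Proc} (hθ : ∀ i, (θ i).Sessionless) :
      (Q.subP fun i => (θ i).sub σ).endpoints = Q.endpoints :=
    endpoints_subP Q fun i => ((hθ i).sub σ).2
  induction P generalizing θ with
  | pvar i => exact (hθ i).1
  | adapt l P ih =>
    refine ⟨ih h.1 ?_, (endpoints_subP P ?_).trans h.2⟩
    · rintro (_ | i)
      exacts [sessionless_pvar 0, (hθ i).renP _]
    · rintro (_ | i)
      exacts [rfl, ((hθ i).renP _).2]
  | _ =>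
    simp_all [Proc.subP, WellAnnotated, UsesVarOnce, endpoints_subP, Sessionless.sub,
      Sessionless.endpoints_eq_zero, -Multiset.mem_filterMap]

theorem Sessionless.instP (h : P.Sessionless) (h' : Q.Sessionless) : (P.instP Q).Sessionless := by
  have hθ : ∀ i, Proc.Sessionless (match i with
      | 0 => Q
      | i + 1 => .pvar i)
    | 0 => h'
    | i + 1 => sessionless_pvar i
  exact ⟨h.1.subP hθ, (endpoints_subP P fun i => (hθ i).2).trans h.2⟩

theorem WellAnnotated.sessionless_of_loc_zero {l : ℕ} (h : (Proc.loc l 0 P).WellAnnotated) :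
    P.Sessionless :=
  ⟨h.1, Multiset.card_eq_zero.1 (by exact_mod_cast h.2.symm)⟩

end Proc

/-! ### Structural congruence -/

theorem Sess.sub_wkC_injective : Function.Injective (Sess.sub Sub.wkC) := by
  rintro (i | ⟨p, i⟩) (j | ⟨q, j⟩) h <;> simp_all [Sess.sub, Sub.wkC, Sub.id]

theorem Sub.swapC_chan_swapC_chan (i : ℕ) : swapC.chan (swapC.chan i) = i := by
  simp only [swapC]
  grind

theorem Sess.sub_swapC_swapC (k : Sess) : (k.sub Sub.swapC).sub Sub.swapC = k := by
  rcases k with i | ⟨p, i⟩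
  · rfl
  · exact congrArg (Sess.chan p) (Sub.swapC_chan_swapC_chan i)

theorem Sess.sub_swapC_eq_chan_iff (k : Sess) (p : Pol) (i : ℕ) :
    k.sub Sub.swapC = .chan p i ↔ k = .chan p (Sub.swapC.chan i) :=
  ⟨fun h => (Sess.sub_swapC_swapC k).symm.trans (congrArg _ h),
    fun h => (congrArg _ h).trans (Sess.sub_swapC_swapC (.chan p i))⟩

theorem Endpoint.unbindC_sub_wkC (e : Endpoint) : unbindC (e.sub Sub.wkC) = e := by
  rcases e with _ | i | ⟨p, i⟩ <;> rfl

theorem Endpoint.unbindC_unbindC_sub_swapC (e : Endpoint) :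
    unbindC (unbindC (e.sub Sub.swapC)) = unbindC (unbindC e) := by
  rcases e with _ | i | ⟨p, _ | _ | i⟩ <;> rfl

theorem Cong.endpoints_eq (h : Cong P Q) : P.endpoints = Q.endpoints := by
  induction h with
  | resSwap P =>
    simp only [Proc.endpoints, Proc.endpoints_sub, Multiset.map_map, Function.comp_def,
      Endpoint.unbindC_unbindC_sub_swapC]
  | resPar P Q =>
    simp only [Proc.endpoints, Proc.endpoints_sub, Multiset.map_add, Multiset.map_map,
      Function.comp_def, Endpoint.unbindC_sub_wkC, Multiset.map_id']
  | parComm P Q => exact add_comm _ _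
  | parAssoc P Q R => exact add_assoc _ _ _
  | _ => simp_all [Proc.endpoints]

theorem Cong.wellAnnotated_iff (h : Cong P Q) : P.WellAnnotated ↔ Q.WellAnnotated := by
  induction h with
  | resSwap P =>
    exact (Proc.wellAnnotated_sub_iff (P := P)
      (Function.LeftInverse.injective Sess.sub_swapC_swapC)).symm
  | resPar P Q =>
    exact and_congr_right fun _ => (Proc.wellAnnotated_sub_iff Sess.sub_wkC_injective).symm
  | parComm P Q => exact and_comm
  | parAssoc P Q R => exact and_assoc
  | resLoc l n P => simp only [Proc.WellAnnotated, Proc.endpoints, Multiset.card_map]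
  | cond e h h' ih ih' => simp only [Proc.WellAnnotated, ih, ih', h.endpoints_eq, h'.endpoints_eq]
  | branch k m lab h ih => simp only [Proc.WellAnnotated, ih, (h _).endpoints_eq]
  | accept a h ih | repAccept a h ih | request a h ih | loc l n h ih | adapt l h ih
  | send k es h ih | recv k n h ih | sendSess k k' h ih | recvSess k h ih | select k n h ih =>
    simp only [Proc.WellAnnotated, Proc.UsesVarOnce, ih, h.endpoints_eq]
  | _ => simp_all [Proc.WellAnnotated]

/-! ### Typed processes -/

/-- The endpoint to which an assignment gives a session type. -/
def Assign.endpoint : Assign → Endpoint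
  | .act k _ => some k
  | .brk _ _ => none

/-- A typing with the session types erased. -/
def Typing.endpoints (Δ : Typing) : Multiset Endpoint := Multiset.map Assign.endpoint Δ

theorem Assign.endpoint_sub (σ : Sub) (A : Assign) :
    (A.sub σ).endpoint = A.endpoint.sub σ := by
  cases A <;> rfl

theorem Endpoint.unbindS_sub_wkS (e : Endpoint) : unbindS (e.sub Sub.wkS) = some e := by
  rcases e with _ | i | ⟨p, i⟩ <;> rfl

namespace Typing

theorem endpoints_cons (A : Assign) (Δ : Typing) :
    endpoints (A ::ₘ Δ) = A.endpoint ::ₘ Δ.endpoints :=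
  Multiset.map_cons _ _ _

theorem endpoints_sub (σ : Sub) (Δ : Typing) :
    (Δ.sub σ).endpoints = Δ.endpoints.map (Endpoint.sub σ) := by
  simp only [endpoints, sub, Multiset.map_map, Function.comp_def, Assign.endpoint_sub]

theorem card_endpoints (Δ : Typing) : Δ.endpoints.card = Multiset.card Δ :=
  Multiset.card_map _ _

theorem filterMap_unbindS_endpoints_sub_wkS (Δ : Typing) :
    (Δ.sub Sub.wkS).endpoints.filterMap Endpoint.unbindS = Δ.endpoints := by
  rw [endpoints_sub, Multiset.filterMap_map,
    show Endpoint.unbindS ∘ Endpoint.sub Sub.wkS = some from funext Endpoint.unbindS_sub_wkS,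
    Multiset.filterMap_some]

theorem map_unbindC_endpoints_sub_wkC (Δ : Typing) :
    (Δ.sub Sub.wkC).endpoints.map Endpoint.unbindC = Δ.endpoints := by
  simp only [endpoints_sub, Multiset.map_map, Function.comp_def, Endpoint.unbindC_sub_wkC,
    Multiset.map_id']

theorem filterMap_unbindS_endpoints_bind (α : STy) (Δ : Typing) :
    (endpoints (Assign.act (.svar 0) α ::ₘ Δ.sub Sub.wkS)).filterMap Endpoint.unbindS =
      Δ.endpoints := by
  rw [endpoints_cons, Multiset.filterMap_cons_none _ _ rfl, filterMap_unbindS_endpoints_sub_wkS]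

theorem sub_cons (σ : Sub) (A : Assign) (Δ : Typing) :
    sub σ (A ::ₘ Δ) = A.sub σ ::ₘ Δ.sub σ :=
  Multiset.map_cons _ _ _

end Typing

namespace Typed

variable {Γ : Gamma} {Θ : Theta} {Δ : Typing} {I : Interface}

theorem endpoints_eq (h : Typed Γ Θ P Δ I) : P.endpoints = Δ.endpoints := by
  induction h with
  | accept _ _ ih | request _ _ ih =>
    rw [Proc.endpoints, ih, Typing.filterMap_unbindS_endpoints_bind]
  | recvSess _ _ ih =>
    rw [Proc.endpoints, ih, ← Assign.sub, ← Typing.sub_cons,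
      Typing.filterMap_unbindS_endpoints_bind]
    simp only [Typing.endpoints_cons, Assign.endpoint]
  | sendSess _ _ _ _ ih =>
    simp only [Proc.endpoints, ih, Typing.endpoints_cons, Assign.endpoint]
    exact Multiset.cons_swap _ _ _
  | res _ ih =>
    simp only [Proc.endpoints, ih, Typing.endpoints_cons, Assign.endpoint, Multiset.map_cons,
      Typing.map_unbindC_endpoints_sub_wkC, Endpoint.unbindC]
  | resUnused _ ih => rw [Proc.endpoints, ih, Typing.map_unbindC_endpoints_sub_wkC]
  | par _ _ _ ih ih' => rw [Proc.endpoints, ih, ih']; exact (Multiset.map_add _ _ _).symm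
  | nil | pvar | repAccept | adapt => rfl
  | _ => simp_all only [Proc.endpoints, Typing.endpoints_cons, Assign.endpoint]

theorem mem_endpoints {k : Sess} {α : STy} (h : Typed Γ Θ P (Assign.act k α ::ₘ Δ) I) :
    some k ∈ P.endpoints := by
  rw [h.endpoints_eq, Typing.endpoints_cons]
  exact Multiset.mem_cons_self _ _

theorem usesVarOnce {α : STy} (h : Typed Γ Θ P (Assign.act (.svar 0) α ::ₘ Δ.sub Sub.wkS) I) :
    P.UsesVarOnce := by
  rw [Proc.UsesVarOnce, h.endpoints_eq, Typing.filterMap_unbindS_endpoints_bind,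
    Typing.endpoints_cons, Multiset.card_cons, Typing.endpoints_sub, Multiset.card_map]

theorem wellAnnotated (h : Typed Γ Θ P Δ I) : P.WellAnnotated := by
  induction h with
  | nil | pvar => trivial
  | accept _ h ih | request _ h ih => exact ⟨ih, h.usesVarOnce⟩
  | repAccept _ h ih =>
    refine ⟨ih, h.usesVarOnce (Δ := 0), ?_⟩
    rw [h.endpoints_eq]
    exact Typing.filterMap_unbindS_endpoints_bind _ 0
  | loc _ h hcard _ ih =>
    exact ⟨ih, by rw [h.endpoints_eq, Typing.card_endpoints, hcard]⟩
  | adapt _ h ih => exact ⟨ih, h.endpoints_eq⟩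
  | send _ _ h ih | recv _ h ih | sendSess _ _ _ h ih | select _ _ _ h ih =>
    exact ⟨ih, h.mem_endpoints⟩
  | @recvSess _ _ k α β _ Δ _ _ h ih =>
    rw [← Assign.sub, ← Typing.sub_cons] at h
    refine ⟨ih, h.usesVarOnce, ?_⟩
    rw [h.endpoints_eq, Typing.filterMap_unbindS_endpoints_bind, Typing.endpoints_cons]
    exact Multiset.mem_cons_self _ _
  | branch _ _ _ _ h _ ih =>
    refine ⟨fun i => ⟨ih i, ?_⟩, (h 0).mem_endpoints⟩
    simp only [(h _).endpoints_eq, Typing.endpoints_cons, Assign.endpoint]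
  | cond _ h h' _ _ ih ih' => exact ⟨ih, ih', h'.endpoints_eq.trans h.endpoints_eq.symm⟩
  | par _ _ _ ih ih' => exact ⟨ih, ih'⟩
  | close _ _ ih | res _ ih | resUnused _ ih => exact ih

end Typed

/-! ### Reduction -/

/-- `Q` is well annotated and uses `d` more endpoints than `P`: a subprocess `P` may be replaced
by `Q` if `d` is added to the annotations of the locations around it. -/
structure Proc.EvolvesBy (d : ℤ) (P Q : Proc) : Prop where
  wellAnnotated : Q.WellAnnotated
  card_eq : (Q.endpoints.card : ℤ) = P.endpoints.card + d

namespace Ctx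

theorem bump_zero (C : Ctx) : C.bump 0 = C := by
  induction C <;> simp_all [bump]

theorem fill_wkC (C : Ctx) (X : Proc) : (C.fill X).sub Sub.wkC = C.wkC.fill (X.sub Sub.wkC) := by
  induction C <;> simp_all [wkC, fill, Proc.sub]

theorem wellAnnotated_of_fill {C : Ctx} (h : (C.fill X).WellAnnotated) : X.WellAnnotated := by
  induction C with
  | hole => exact h
  | loc l n C P ih => exact ih h.1.1

end Ctx

namespace Proc

namespace EvolvesBy

variable {C : Ctx} {c d : ℤ}

theorem par (h : P.EvolvesBy c P') (h' : Q.EvolvesBy d Q') :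
    (Proc.par P Q).EvolvesBy (c + d) (.par P' Q') where
  wellAnnotated := ⟨h.1, h'.1⟩
  card_eq := by
    simp only [endpoints, Multiset.card_add, Nat.cast_add, h.2, h'.2]
    ring

theorem res_right (h : P.EvolvesBy d Q) : P.EvolvesBy d (.res Q) where
  wellAnnotated := h.1
  card_eq := by rw [endpoints, Multiset.card_map, h.2]

theorem sub_left_iff : (P.sub σ).EvolvesBy d Q ↔ P.EvolvesBy d Q :=
  ⟨fun h => ⟨h.1, by rw [h.2, card_endpoints_sub]⟩,
    fun h => ⟨h.1, by rw [h.2, card_endpoints_sub]⟩⟩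

theorem fill (h : X.EvolvesBy d Y) (hC : (C.fill X).WellAnnotated) :
    (C.fill X).EvolvesBy d ((C.bump d).fill Y) := by
  induction C with
  | hole => exact h
  | loc l n C P ih =>
    obtain ⟨hY, hcard⟩ := ih hC.1.1
    have hn : n = ((Proc.par (C.fill X) P).endpoints.card : ℤ) := hC.2
    have hpar : ((Proc.par ((C.bump d).fill Y) P).endpoints.card : ℤ) =
        (Proc.par (C.fill X) P).endpoints.card + d := by
      simp only [endpoints, Multiset.card_add, Nat.cast_add, hcard]
      ring
    exact ⟨⟨⟨hY, hC.1.2⟩, by rw [hn, hpar]⟩, hpar⟩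

theorem fill_zero (h : X.EvolvesBy 0 Y) (hC : (C.fill X).WellAnnotated) :
    (C.fill X).EvolvesBy 0 (C.fill Y) := by
  simpa only [Ctx.bump_zero] using h.fill hC

theorem fill_wkC (h : X.EvolvesBy d Y) (hC : (C.fill X).WellAnnotated) :
    (C.fill X).EvolvesBy d ((C.wkC.bump d).fill Y) := by
  have hC' := hC.sub Sub.wkC
  rw [Ctx.fill_wkC] at hC'
  have := (sub_left_iff.2 h).fill hC'
  rwa [← Ctx.fill_wkC, sub_left_iff] at this

end EvolvesBy

theorem WellAnnotated.evolvesBy_zero (hQ : Q.WellAnnotated)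
    (h : Q.endpoints.card = P.endpoints.card) : P.EvolvesBy 0 Q :=
  ⟨hQ, by rw [h, add_zero]⟩

theorem WellAnnotated.cond_evolvesBy_left {e : Expr} (h : (Proc.cond e P Q).WellAnnotated) :
    (Proc.cond e P Q).EvolvesBy 0 P :=
  h.1.evolvesBy_zero rfl

theorem WellAnnotated.cond_evolvesBy_right {e : Expr} (h : (Proc.cond e P Q).WellAnnotated) :
    (Proc.cond e P Q).EvolvesBy 0 Q :=
  h.2.1.evolvesBy_zero (congrArg _ h.2.2)

theorem WellAnnotated.close_evolvesBy {k : Sess} (h : (Proc.close k P).WellAnnotated) :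
    (Proc.close k P).EvolvesBy (-1) P :=
  ⟨h, by simp [endpoints]⟩

theorem WellAnnotated.sendSess_evolvesBy {k k' : Sess}
    (h : (Proc.sendSess k k' P).WellAnnotated) : (Proc.sendSess k k' P).EvolvesBy (-1) P :=
  ⟨h.1, by simp [endpoints]⟩

theorem UsesVarOnce.evolvesBy_sub (h : P.UsesVarOnce) (hP : P.WellAnnotated) (σ : Sub)
    (hQ : Q.endpoints = P.endpoints.filterMap Endpoint.unbindS) : Q.EvolvesBy 1 (P.sub σ) :=
  ⟨hP.sub σ, by rw [card_endpoints_sub, h, hQ, Nat.cast_succ]⟩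

theorem WellAnnotated.repAccept_evolvesBy {a : ℕ} (h : (Proc.repAccept a P).WellAnnotated) :
    (Proc.repAccept a P).EvolvesBy 1
      (.par (P.instNew .pos) ((Proc.repAccept a P).sub Sub.wkC)) := by
  have hinst : (Proc.repAccept a P).EvolvesBy 1 (P.instNew .pos) :=
    h.2.1.evolvesBy_sub h.1 _ h.2.2.symm
  exact ⟨⟨hinst.1, WellAnnotated.sub h Sub.wkC⟩, by simpa [endpoints, Proc.sub] using hinst.2⟩

end Proc

namespace Ctx

variable {E C D : Ctx} {c d : ℤ}

theorem wellAnnotated_fill_par (h : (E.fill (.par (C.fill X) (D.fill Y))).WellAnnotated)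
    (hX : X.WellAnnotated → X.EvolvesBy c X') (hY : Y.WellAnnotated → Y.EvolvesBy d Y') :
    ((E.bump (c + d)).fill (.par ((C.bump c).fill X') ((D.bump d).fill Y'))).WellAnnotated := by
  obtain ⟨hC, hD⟩ := wellAnnotated_of_fill h
  have hCX := (hX (wellAnnotated_of_fill hC)).fill hC
  have hDY := (hY (wellAnnotated_of_fill hD)).fill hD
  exact ((hCX.par hDY).fill h).wellAnnotated

theorem wellAnnotated_fill_par_zero (h : (E.fill (.par (C.fill X) (D.fill Y))).WellAnnotated)
    (hX : X.WellAnnotated → X.EvolvesBy 0 X') (hY : Y.WellAnnotated → Y.EvolvesBy 0 Y') :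
    (E.fill (.par (C.fill X') (D.fill Y'))).WellAnnotated := by
  simpa only [add_zero, bump_zero] using wellAnnotated_fill_par h hX hY

theorem wellAnnotated_fill_res_par (h : (E.fill (.par (C.fill X) (D.fill Y))).WellAnnotated)
    (hX : X.WellAnnotated → X.EvolvesBy c X') (hY : Y.WellAnnotated → Y.EvolvesBy d Y') :
    ((E.bump (c + d)).fill
      (.res (.par ((C.wkC.bump c).fill X') ((D.wkC.bump d).fill Y')))).WellAnnotated := by
  obtain ⟨hC, hD⟩ := wellAnnotated_of_fill h
  have hCX := (hX (wellAnnotated_of_fill hC)).fill_wkC hC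
  have hDY := (hY (wellAnnotated_of_fill hD)).fill_wkC hD
  exact ((hCX.par hDY).res_right.fill h).wellAnnotated

end Ctx

theorem UpdRule.wellAnnotated (h : UpdRule P Q) (hP : P.WellAnnotated) : Q.WellAnnotated := by
  obtain ⟨E, C, D, l, P, Q⟩ := h
  have hA := Ctx.wellAnnotated_of_fill (Ctx.wellAnnotated_of_fill hP).2
  refine Ctx.wellAnnotated_fill_par_zero hP (fun hQ => ?_) fun _ =>
    Proc.WellAnnotated.evolvesBy_zero trivial rfl
  have hPQ := Proc.Sessionless.instP ⟨hA.1, hA.2⟩ hQ.sessionless_of_loc_zero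
  exact hPQ.1.evolvesBy_zero
    (by rw [Proc.endpoints, hPQ.2, hQ.sessionless_of_loc_zero.endpoints_eq_zero])

theorem CommRule.wellAnnotated (h : CommRule P Q) (hP : P.WellAnnotated) : Q.WellAnnotated := by
  cases h with
  | ifTrue => exact ((Ctx.wellAnnotated_of_fill hP).cond_evolvesBy_left.fill_zero hP).1
  | ifFalse => exact ((Ctx.wellAnnotated_of_fill hP).cond_evolvesBy_right.fill_zero hP).1
  | opn =>
    exact Ctx.wellAnnotated_fill_res_par hP (fun h => h.2.evolvesBy_sub h.1 _ rfl)
      fun h => h.2.evolvesBy_sub h.1 _ rfl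
  | ropn =>
    exact Ctx.wellAnnotated_fill_res_par hP Proc.WellAnnotated.repAccept_evolvesBy
      fun h => h.2.evolvesBy_sub h.1 _ rfl
  | io E C D p i n es cs P Q =>
    exact Ctx.wellAnnotated_fill_par_zero hP (fun h => h.1.evolvesBy_zero rfl)
      fun h => (h.1.sub _).evolvesBy_zero (Q.card_endpoints_sub _)
  | pass E =>
    rw [← E.bump_zero]
    exact Ctx.wellAnnotated_fill_par hP Proc.WellAnnotated.sendSess_evolvesBy
      fun h => h.2.1.evolvesBy_sub h.1 _ rfl
  | sel E C D p i m lab P j =>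
    exact Ctx.wellAnnotated_fill_par_zero hP (fun h => (h.1 j).1.evolvesBy_zero
      (congrArg _ (h.1 j).2)) fun h => h.1.evolvesBy_zero rfl
  | close =>
    exact Ctx.wellAnnotated_fill_par hP Proc.WellAnnotated.close_evolvesBy
      Proc.WellAnnotated.close_evolvesBy

theorem RedClosure.wellAnnotated {B : Proc → Proc → Prop}
    (hB : ∀ {P Q}, B P Q → P.WellAnnotated → Q.WellAnnotated) (h : RedClosure B P Q)
    (hP : P.WellAnnotated) : Q.WellAnnotated := by
  induction h with
  | base h => exact hB h hP
  | str h _ h' ih => exact h'.wellAnnotated_iff.1 (ih (h.wellAnnotated_iff.1 hP))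
  | par Q _ ih => exact ⟨ih hP.1, hP.2⟩
  | res _ ih => exact ih hP

theorem Red.wellAnnotated (h : Red P Q) (hP : P.WellAnnotated) : Q.WellAnnotated :=
  RedClosure.wellAnnotated (fun h => h.elim UpdRule.wellAnnotated CommRule.wellAnnotated) h hP

/-! ### Actions and redexes -/

theorem Sess.sub_liftC_eq_zero_iff (σ : Sub) (k : Sess) (p : Pol) :
    k.sub σ.liftC = .chan p 0 ↔ k = .chan p 0 := by
  rcases k with i | ⟨q, _ | i⟩ <;> simp only [Sess.sub, Sub.liftC]
  · cases σ.sess i <;> simp [Sub.wkC, Sub.id]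
  · simp

theorem Sess.sub_liftC_eq_succ_iff (σ : Sub) (k : Sess) (p : Pol) (i : ℕ) :
    k.sub σ.liftC = .chan p (i + 1) ↔
      ∃ k', Endpoint.unbindC (some k) = some k' ∧ k'.sub σ = .chan p i := by
  rcases k with j | ⟨q, _ | j⟩ <;> simp only [Sess.sub, Sub.liftC, Endpoint.unbindC]
  · cases h : σ.sess j <;> simp [Sub.wkC, Sub.id, h]
  · simp
  · simp

theorem Sess.sub_liftC_eq_succ_iff_eq_succ {p : Pol} {i j : ℕ}
    (hσ : ∀ k : Sess, k.sub σ = .chan p j ↔ k = .chan p i) (k : Sess) :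
    k.sub σ.liftC = .chan p (j + 1) ↔ k = .chan p (i + 1) := by
  rw [sub_liftC_eq_succ_iff]
  simp only [hσ, exists_eq_right]
  rcases k with n | ⟨q, _ | n⟩ <;> simp [Endpoint.unbindC]

theorem Sess.sub_wkC_ne_zero (k : Sess) (p : Pol) : k.sub Sub.wkC ≠ .chan p 0 := by
  cases k <;> simp [Sess.sub, Sub.wkC, Sub.id]

theorem Sess.sub_wkC_eq_succ_iff (k : Sess) (p : Pol) (i : ℕ) :
    k.sub Sub.wkC = .chan p (i + 1) ↔ k = .chan p i := by
  cases k <;> simp [Sess.sub, Sub.wkC, Sub.id]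

theorem Pol.dual_dual (p : Pol) : p.dual.dual = p := by cases p <;> rfl

namespace Proc

theorem hasAct_sub_iff {p : Pol} {i j : ℕ} {a : Act}
    (hσ : ∀ k : Sess, k.sub σ = .chan p j ↔ k = .chan p i) :
    (P.sub σ).HasAct j p a ↔ P.HasAct i p a := by
  induction P generalizing σ i j with
  | res _ ih => exact ih (Sess.sub_liftC_eq_succ_iff_eq_succ hσ)
  | _ => simp_all [Proc.sub, HasAct]

theorem not_hasAct_sub {p : Pol} {j : ℕ} {a : Act} (hσ : ∀ k : Sess, k.sub σ ≠ .chan p j) :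
    ¬ (P.sub σ).HasAct j p a := by
  induction P generalizing σ j with
  | res _ ih =>
    refine ih fun k hk => ?_
    obtain ⟨k', -, hk'⟩ := (Sess.sub_liftC_eq_succ_iff σ k p j).1 hk
    exact hσ k' hk'
  | _ => simp_all [Proc.sub, HasAct]

theorem hasRedex_sub_iff {i j : ℕ}
    (hσ : ∀ (p : Pol) (k : Sess), k.sub σ = .chan p j ↔ k = .chan p i) :
    (P.sub σ).HasRedex j ↔ P.HasRedex i := by
  induction P generalizing σ i j with
  | res _ ih => exact ih fun p => Sess.sub_liftC_eq_succ_iff_eq_succ (hσ p)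
  | par P Q ihP ihQ => simp only [Proc.sub, HasRedex, ihP hσ, ihQ hσ, hasAct_sub_iff (hσ _)]
  | loc _ _ _ ih => exact ih hσ
  | _ => exact Iff.rfl

theorem hasRestrictedRedex_sub_iff :
    (P.sub σ).HasRestrictedRedex ↔ P.HasRestrictedRedex := by
  induction P generalizing σ with
  | res P ih => exact or_congr (hasRedex_sub_iff fun p k => Sess.sub_liftC_eq_zero_iff σ k p) ih
  | par P Q ihP ihQ => exact or_congr ihP ihQ
  | loc _ _ _ ih => exact ih
  | _ => exact Iff.rfl

theorem HasRedex.exists_hasAct {i : ℕ} (h : P.HasRedex i) : ∃ p a, P.HasAct i p a := by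
  induction P generalizing i with
  | par P Q ihP ihQ =>
    rcases h with h | h | ⟨p, a, -, -, h, -⟩
    · obtain ⟨p, a, h⟩ := ihP h
      exact ⟨p, a, .inl h⟩
    · obtain ⟨p, a, h⟩ := ihQ h
      exact ⟨p, a, .inr h⟩
    · exact ⟨p, a, .inl h⟩
  | loc l n P ih | res P ih => exact ih h
  | _ => exact h.elim

theorem HasRedex.par_comm {i : ℕ} : (Proc.par P Q).HasRedex i → (Proc.par Q P).HasRedex i
  | .inl h => .inr (.inl h)
  | .inr (.inl h) => .inl h
  | .inr (.inr ⟨p, a, b, hab, ha, hb⟩) =>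
    .inr (.inr ⟨p.dual, b, a, hab.symm, hb, by rwa [Pol.dual_dual]⟩)

end Proc

theorem Cong.hasAct_iff (h : Cong P Q) (i : ℕ) (p : Pol) (a : Act) :
    P.HasAct i p a ↔ Q.HasAct i p a := by
  induction h generalizing i with
  | symm _ ih => exact (ih i).symm
  | trans _ _ ih ih' => exact (ih i).trans (ih' i)
  | parComm P Q => exact or_comm
  | parAssoc P Q R => exact or_assoc
  | parNil P => exact iff_of_eq (or_false _)
  | resSwap P =>
    exact (Proc.hasAct_sub_iff (P := P) fun k => Sess.sub_swapC_eq_chan_iff k p (i + 2)).symm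
  | resPar P Q => exact or_congr_right (Proc.hasAct_sub_iff (Sess.sub_wkC_eq_succ_iff · p i)).symm
  | par _ _ ih ih' => exact or_congr (ih i) (ih' i)
  | res _ ih => exact ih (i + 1)
  | loc _ _ _ ih => exact ih i
  | _ => exact Iff.rfl

theorem Cong.hasRedex_iff (h : Cong P Q) (i : ℕ) : P.HasRedex i ↔ Q.HasRedex i := by
  induction h generalizing i with
  | symm _ ih => exact (ih i).symm
  | trans _ _ ih ih' => exact (ih i).trans (ih' i)
  | parComm P Q => exact ⟨.par_comm, .par_comm⟩
  | parAssoc P Q R =>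
    simp only [Proc.HasRedex, Proc.HasAct]
    grind
  | parNil P => simp [Proc.HasRedex, Proc.HasAct]
  | resSwap P =>
    exact (Proc.hasRedex_sub_iff (P := P) fun p k =>
      Sess.sub_swapC_eq_chan_iff k p (i + 2)).symm
  | resPar P Q =>
    simp only [Proc.HasRedex, Proc.HasAct,
      Proc.hasRedex_sub_iff fun p k => Sess.sub_wkC_eq_succ_iff k p i,
      Proc.hasAct_sub_iff fun k => Sess.sub_wkC_eq_succ_iff k _ i]
  | par h h' ih ih' => simp only [Proc.HasRedex, ih, ih', h.hasAct_iff, h'.hasAct_iff]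
  | res _ ih => exact ih (i + 1)
  | loc _ _ _ ih => exact ih i
  | _ => exact Iff.rfl

theorem Cong.hasRestrictedRedex_iff (h : Cong P Q) :
    P.HasRestrictedRedex ↔ Q.HasRestrictedRedex := by
  induction h with
  | symm _ ih => exact ih.symm
  | trans _ _ ih ih' => exact ih.trans ih'
  | parComm P Q => exact or_comm
  | parAssoc P Q R => exact or_assoc
  | parNil P => exact iff_of_eq (or_false _)
  | resNil => simp [Proc.HasRestrictedRedex, Proc.HasRedex]
  | resSwap P =>
    simp only [Proc.HasRestrictedRedex, Proc.HasRedex, Proc.hasRestrictedRedex_sub_iff,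
      Proc.hasRedex_sub_iff fun p k => Sess.sub_swapC_eq_chan_iff k p _]
    exact or_left_comm
  | resPar P Q =>
    have hact (p : Pol) (a : Act) : ¬ (Q.sub Sub.wkC).HasAct 0 p a :=
      Proc.not_hasAct_sub fun k => Sess.sub_wkC_ne_zero k p
    have hredex : ¬ (Q.sub Sub.wkC).HasRedex 0 := fun h =>
      let ⟨p, a, ha⟩ := h.exists_hasAct
      hact p a ha
    simp [Proc.HasRestrictedRedex, Proc.HasRedex, Proc.hasRestrictedRedex_sub_iff, hact, hredex,
      or_assoc]
  | par _ _ ih ih' => exact or_congr ih ih'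
  | res h ih => exact or_congr (h.hasRedex_iff 0) ih
  | loc _ _ _ ih => exact ih
  | _ => exact Iff.rfl

/-! ### Preservation of redexes -/

/-- The preorder of processes by the actions and redexes that they contain. A process is below
what an update makes of it. -/
structure Proc.RedexLE (P Q : Proc) : Prop where
  act : ∀ {i p a}, P.HasAct i p a → Q.HasAct i p a
  redex : ∀ {i}, P.HasRedex i → Q.HasRedex i
  restricted : P.HasRestrictedRedex → Q.HasRestrictedRedex

namespace Proc

theorem WellAnnotated.mem_endpoints_of_hasAct (h : P.WellAnnotated) {i : ℕ} {p : Pol} {a : Act}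
    (ha : P.HasAct i p a) : some (.chan p i) ∈ P.endpoints := by
  induction P generalizing i with
  | par P Q ihP ihQ => exact Multiset.mem_add.2 (ha.imp (ihP h.1) (ihQ h.2))
  | loc l n P ih => exact ih h.1 ha
  | res P ih => exact Multiset.mem_map.2 ⟨_, ih h ha, rfl⟩
  | send | recv | select | branch => exact ha.1 ▸ h.2
  | sendSess k k' P => exact Multiset.mem_cons_of_mem (ha.1 ▸ h.2)
  | recvSess => exact ha.1 ▸ h.2.2
  | close k P => exact ha.1 ▸ Multiset.mem_cons_self _ _
  | _ => exact ha.elim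

theorem WellAnnotated.none_mem_endpoints_of_hasRestrictedRedex (h : P.WellAnnotated)
    (hr : P.HasRestrictedRedex) : none ∈ P.endpoints := by
  induction P with
  | par P Q ihP ihQ => exact Multiset.mem_add.2 (hr.imp (ihP h.1) (ihQ h.2))
  | loc l n P ih => exact ih h.1 hr
  | res P ih =>
    rcases hr with hr | hr
    · obtain ⟨p, a, ha⟩ := hr.exists_hasAct
      exact Multiset.mem_map.2 ⟨some (.chan p 0), mem_endpoints_of_hasAct (P := P) h ha, rfl⟩
    · exact Multiset.mem_map.2 ⟨none, ih h hr, rfl⟩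
  | _ => exact hr.elim

namespace RedexLE

theorem refl (P : Proc) : P.RedexLE P := ⟨id, id, id⟩

theorem trans {R : Proc} (h : P.RedexLE Q) (h' : Q.RedexLE R) : P.RedexLE R :=
  ⟨h'.1 ∘ h.1, h'.2 ∘ h.2, h'.3 ∘ h.3⟩

theorem par (h : P.RedexLE P') (h' : Q.RedexLE Q') : (Proc.par P Q).RedexLE (.par P' Q') where
  act := Or.imp h.act h'.act
  redex := Or.imp h.redex (Or.imp h'.redex fun ⟨p, a, b, hab, ha, hb⟩ =>
    ⟨p, a, b, hab, h.act ha, h'.act hb⟩)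
  restricted := Or.imp h.restricted h'.restricted

theorem loc (h : P.RedexLE Q) (l : ℕ) (n : ℤ) : (Proc.loc l n P).RedexLE (.loc l n Q) :=
  ⟨h.act, h.redex, h.restricted⟩

theorem res (h : P.RedexLE Q) : (Proc.res P).RedexLE (.res Q) :=
  ⟨h.act, h.redex, Or.imp h.redex h.restricted⟩

theorem fill (h : X.RedexLE Y) (C : Ctx) : (C.fill X).RedexLE (C.fill Y) := by
  induction C with
  | hole => exact h
  | loc l n C P ih => exact (ih.par (refl P)).loc l n

end RedexLE

theorem Sessionless.redexLE (h : P.Sessionless) (Q : Proc) : P.RedexLE Q := by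
  have hact {i p a} : ¬ P.HasAct i p a := fun ha => by
    simpa [h.endpoints_eq_zero] using h.wellAnnotated.mem_endpoints_of_hasAct ha
  refine ⟨fun ha => (hact ha).elim, fun hr => ?_, fun hr => ?_⟩
  · obtain ⟨p, a, ha⟩ := hr.exists_hasAct
    exact (hact ha).elim
  · simpa [h.endpoints_eq_zero] using h.wellAnnotated.none_mem_endpoints_of_hasRestrictedRedex hr

end Proc

theorem Cong.redexLE (h : Cong P Q) : P.RedexLE Q :=
  ⟨(h.hasAct_iff _ _ _).1, (h.hasRedex_iff _).1, h.hasRestrictedRedex_iff.1⟩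

theorem UpdRule.redexLE (h : UpdRule P Q) (hP : P.WellAnnotated) : P.RedexLE Q := by
  obtain ⟨E, C, D, l, P, Q⟩ := h
  obtain ⟨hC, hD⟩ := Ctx.wellAnnotated_of_fill hP
  have hQ := (Ctx.wellAnnotated_of_fill hC).sessionless_of_loc_zero
  have hloc : (Proc.loc l 0 Q).Sessionless := ⟨Ctx.wellAnnotated_of_fill hC, hQ.2⟩
  have hadapt : (Proc.adapt l P).Sessionless := ⟨Ctx.wellAnnotated_of_fill hD, rfl⟩
  exact (((hloc.redexLE _).fill C).par ((hadapt.redexLE _).fill D)).fill E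

theorem UpdRed.redexLE (h : UpdRed P Q) (hP : P.WellAnnotated) : P.RedexLE Q := by
  induction h with
  | base h => exact h.redexLE hP
  | str h _ h' ih => exact (h.redexLE.trans (ih (h.wellAnnotated_iff.1 hP))).trans h'.redexLE
  | par Q _ ih => exact (ih hP.1).par (.refl Q)
  | res _ ih => exact (ih hP).res

theorem Proc.wellAnnotated_res_iterate (n : ℕ) (P : Proc) :
    (Proc.res^[n] P).WellAnnotated ↔ P.WellAnnotated := by
  induction n generalizing P with
  | zero => exact Iff.rfl
  | succ _ ih => exact ih (.res P)

theorem Proc.WellAnnotated.updateConsistent (hP : P.WellAnnotated) : UpdateConsistent P := by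
  intro P' hred
  have hP' : P'.WellAnnotated := by
    induction hred with
    | refl => exact hP
    | tail _ h ih => exact h.wellAnnotated ih
  refine ⟨fun κ _ hr h => (h.redexLE hP').redex hr, fun _ hr h => (h.redexLE hP').restricted hr,
    fun n R hcong κ _ hr h => ?_⟩
  have hR : R.WellAnnotated := (wellAnnotated_res_iterate n R).1 (hcong.wellAnnotated_iff.1 hP')
  exact (h.redexLE hR).redex hr

end AdaptableSessions

open AdaptableSessions in
theorem theorem3_general {Γ : Gamma} {Θ : Theta} {P : Proc} {Δ : Typing} {I : Interface}
    (hP : Typed Γ Θ P Δ I) : UpdateConsistent P :=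
  hP.wellAnnotated.updateConsistent

open AdaptableSessions in
theorem theorem3 (Γ : Gamma) (Θ : Theta) (P : Proc) (Δ : Typing) (I : Interface)
    (hP : Typed Γ Θ P Δ I) (hΔ : Balanced Δ) : UpdateConsistent P :=
  theorem3_general hP
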